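/- **Theorem 3.1.** A field extension $A \subseteq B$ is called *radical* if $B = A[\alpha]$ for some $\alpha \in B$ with $\alpha^n \in A$ for some integer $n \ge 1$, and *repeated radical* if there are fields $A = L_0 \subseteq L_1 \subseteq \cdots \subseteq L_r = B$ with each $L_{i-1} \subseteq L_i$ radical. A field is *quasireal* if it has characteristic zero and its only roots of unity are $\pm 1$. Let $Q \subseteq L$ be fields with $L$ quasireal, let $E \supseteq L$ be a finite Galois extension of $Q$, and let $F$ be a field with $Q \subseteq F \subseteq E$ that is abelian over $Q$ (that is, Galois over $Q$ with abelian Galois group) and contains all roots of unity in $E$. Write $G = \mathrm{Gal}(E/Q)$, $U = \mathrm{Gal}(E/L)$, $N = \mathrm{Gal}(E/F)$ and $M = U \cap N$. Then $L$ is a repeated radical extension of $Q$ if and only if the following two conditions hold: 1. $[F \cap L : Q]$ is a power of $2$ (possibly $2^0 = 1$); 2. there is a chain of subgroups $M = M_0 \subseteq M_1 \subseteq \cdots \subseteq M_r = N$ of $G$ (with $r \ge 0$), each invariant under conjugation by $U$, such that for every $0 < i \le r$ the subgroup $M_{i-1}$ is normal of prime index in $M_i$ and the factor $M_i/M_{i-1}$,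 with $U$ acting by conjugation, is $U$-isomorphic to a subgroup of the multiplicative group $E^\times$, on which $U$ acts by field automorphisms (that is, there is a group isomorphism commuting with the actions of $U$). -/

import Mathlib

/-- A field is quasireal if it has characteristic zero and its only roots of unity are `1` and `-1`.
(`IsOfFinOrder ζ` says that `ζ ^ n = 1` for some `n > 0`.) -/
def IsQuasireal (K : Type*) [Field K] : Prop :=
  CharZero K ∧ ∀ ζ : K, IsOfFinOrder ζ → ζ = 1 ∨ ζ = -1

section Radical

variable {Q E : Type*} [Field Q] [Field E] [Algebra Q E]

/-- For fields `A`, `B` between `Q` and `E`: `A ⊆ B` is a radical extension, that is, `B = A[α]`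
with `α ^ n ∈ A` for some `n > 0`. Such an `α` is algebraic over `A`, so that `A[α]` is the field
`A(α)`, the compositum of `A` and `Q(α)`. -/
def IsRadicalExtension (A B : IntermediateField Q E) : Prop :=
  ∃ α : E, (∃ n : ℕ, 0 < n ∧ α ^ n ∈ A) ∧ B = A ⊔ IntermediateField.adjoin Q {α}

/-- For fields `A`, `B` between `Q` and `E`: `A ⊆ B` is a repeated radical extension, that is, there
are fields `A = K 0 ⊆ K 1 ⊆ ⋯ ⊆ K r = B`, each of which is a radical extension of the one before. -/
def IsRepeatedRadicalExtension (A B : IntermediateField Q E) : Prop :=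
  ∃ (r : ℕ) (K : ℕ → IntermediateField Q E),
    K 0 = A ∧ K r = B ∧ ∀ i < r, IsRadicalExtension (K i) (K (i + 1))

/-- `H` is mapped to itself by the conjugation action of the subgroup `U`. -/
def IsInvariantUnder {G : Type*} [Group G] (U H : Subgroup G) : Prop :=
  ∀ u ∈ U, ∀ h ∈ H, u * h * u⁻¹ ∈ H

/-- For a `U`-invariant subgroup `H` of `Gal(E/Q)` and a normal subgroup `K` of `H`:
the factor group `H / K`, on which `U` acts by conjugation, is `U`-isomorphic to a subgroup `D` of
the multiplicative group `Eˣ`, on which `U` acts as automorphisms of `E`. -/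
def FactorUIsoSubgroupOfUnits (U K H : Subgroup (E ≃ₐ[Q] E)) : Prop :=
  ∃ (hH : IsInvariantUnder U H) (_ : (K.subgroupOf H).Normal)
    (D : Subgroup Eˣ) (φ : (H ⧸ K.subgroupOf H) ≃* D),
    ∀ (u : E ≃ₐ[Q] E) (hu : u ∈ U) (h : H),
      ((φ (QuotientGroup.mk (⟨u * (h : E ≃ₐ[Q] E) * u⁻¹, hH u hu h h.2⟩ : H)) : Eˣ) : E) =
        u ((φ (QuotientGroup.mk h) : Eˣ) : E)

end Radical

open IntermediateField

/-! Under the Galois correspondence, `U ⊔ N` fixes `F ⊓ L`, and `N` fixes every root of unity of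
`E`.

From radicals to groups: refine the tower to steps `B = A(α)` with `α ^ p ∈ A`, `p` prime. On
`Gal(E/A) ⊓ N` the map `g ↦ g α / α` is a homomorphism, because `N` fixes roots of unity; its kernel
is `Gal(E/B) ⊓ N`, and it commutes with `U` because `U` fixes `α`. Intersecting with `N` therefore
gives the chain (`IsPrimeRadicalExtension.inf_eq_or_isKummerStep`). The degree of `F ⊓ B` changes
only when `B / A` is Galois, and then `B ⊆ L` contains a nontrivial `p`-th root of unity, so `p = 2`
(`IsPrimeRadicalExtension.exists_index_sup_eq_two_pow`).

From groups to radicals: `F ⊓ L` is abelian of 2-power degree, hence a tower of quadratic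
extensions. Above it, each factor embeds in the roots of unity; the embedding extends to a cocycle
on `U ⊔ C'`, and Hilbert 90 turns that cocycle into a radical generator
(`isRadicalExtension_of_factorUIso`). -/

/-- A relation chain is the same as a finite sequence of related elements. -/
theorem Relation.reflTransGen_iff_exists_nat_seq {X : Type*} {R : X → X → Prop} {a b : X} :
    Relation.ReflTransGen R a b ↔
      ∃ (r : ℕ) (f : ℕ → X), f 0 = a ∧ f r = b ∧ ∀ i < r, R (f i) (f (i + 1)) := by
  constructor
  · intro h
    induction h with
    | refl => exact ⟨0, fun _ => a, rfl, rfl, fun i hi => absurd hi (Nat.not_lt_zero i)⟩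
    | @tail b c _ hbc ih =>
      obtain ⟨r, f, h0, hr, hf⟩ := ih
      refine ⟨r + 1, fun i => if i ≤ r then f i else c, by simpa using h0, by simp, ?_⟩
      intro i hi
      rcases Nat.lt_or_ge i r with hlt | hge
      · simpa [hlt.le, Nat.succ_le_of_lt hlt] using hf i hlt
      · obtain rfl : i = r := by omega
        simpa [hr] using hbc
  · rintro ⟨r, f, rfl, rfl, hf⟩
    induction r with
    | zero => exact .refl
    | succ r ih => exact (ih fun i hi => hf i (by omega)).tail (hf r (by omega))

/-! ### Hilbert 90 and radical extensions from cocycles -/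

section

variable {Q E : Type*} [Field Q] [Field E] [Algebra Q E]

/-- **Hilbert 90** for a subgroup of a Galois group and a multiplicative 1-cocycle. -/
theorem exists_ne_zero_forall_apply_eq_mul [FiniteDimensional Q E]
    (H : Subgroup (E ≃ₐ[Q] E)) (c : (E ≃ₐ[Q] E) → Eˣ)
    (hc : ∀ g ∈ H, ∀ h ∈ H, (c (g * h) : E) = c g * g (c h)) :
    ∃ α : E, α ≠ 0 ∧ ∀ g ∈ H, g α = c g * α := by
  classical
  have hli : LinearIndependent E (fun (h : H) => ((h : E ≃ₐ[Q] E) : E → E)) := by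
    refine (linearIndependent_monoidHom E E).comp
      (fun h : H => (((h : E ≃ₐ[Q] E) : E →+* E) : E →* E)) fun a b hab => ?_
    ext x
    exact DFunLike.congr_fun hab x
  have := Fintype.ofFinite H
  -- Independence of automorphisms makes this sum nonzero for some `x`. It satisfies `c g * g β =
  -- β`, so its inverse is the element sought.
  obtain ⟨x, hx⟩ : ∃ x, ∑ h : H, (c h : E) * (h : E ≃ₐ[Q] E) x ≠ 0 := by
    by_contra! hcon
    refine (c 1).ne_zero (Fintype.linearIndependent_iff.mp hli (fun h => (c h : E)) ?_ 1)
    ext x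
    simpa [Finset.sum_apply] using hcon x
  set β := ∑ h : H, (c h : E) * (h : E ≃ₐ[Q] E) x with hβ
  have key : ∀ g ∈ H, c g * g β = β := by
    intro g hg
    rw [hβ, map_sum, Finset.mul_sum]
    refine Eq.trans ?_ (Equiv.sum_comp (Equiv.mulLeft (⟨g, hg⟩ : H))
      fun h : H => (c h : E) * (h : E ≃ₐ[Q] E) x)
    refine Finset.sum_congr rfl fun h _ => ?_
    simp [hc g hg h h.2, mul_assoc]
  refine ⟨β⁻¹, inv_ne_zero hx, fun g hg => ?_⟩
  have hg' : g β ≠ 0 := by simpa using hx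
  rw [map_inv₀]
  have := key g hg
  field_simp
  linear_combination -this

theorem mem_fixingSubgroup_sup_adjoin {A : IntermediateField Q E} {α : E} {g : E ≃ₐ[Q] E} :
    g ∈ (A ⊔ adjoin Q {α}).fixingSubgroup ↔ g ∈ A.fixingSubgroup ∧ g α = α := by
  rw [fixingSubgroup_sup, Subgroup.mem_inf]
  refine and_congr_right fun _ => ?_
  rw [← Subgroup.zpowers_le, ← IntermediateField.le_iff_le, adjoin_simple_le_iff,
    mem_fixedField_iff]
  refine ⟨fun h => h g (Subgroup.mem_zpowers g), fun h f hf => ?_⟩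
  have : Subgroup.zpowers g ≤ MulAction.stabilizer (E ≃ₐ[Q] E) α := by
    rwa [Subgroup.zpowers_le]
  exact this hf

variable [FiniteDimensional Q E] [IsGalois Q E]

theorem IntermediateField.mem_iff_forall_mem_fixingSubgroup {A : IntermediateField Q E} {x : E} :
    x ∈ A ↔ ∀ g ∈ A.fixingSubgroup, g x = x := by
  conv_lhs => rw [← IsGalois.fixedField_fixingSubgroup A]
  exact mem_fixedField_iff _ _

/-- A cocycle of finite exponent yields a radical extension of fixed fields. -/
theorem isRadicalExtension_fixedField_of_cocycle {H K : Subgroup (E ≃ₐ[Q] E)}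
    (c : (E ≃ₐ[Q] E) → Eˣ)
    (hc : ∀ g ∈ H, ∀ h ∈ H, (c (g * h) : E) = c g * g (c h))
    {n : ℕ} (hn : 0 < n) (hcn : ∀ g ∈ H, c g ^ n = 1)
    (hK : ∀ g, g ∈ K ↔ g ∈ H ∧ c g = 1) :
    IsRadicalExtension (fixedField H) (fixedField K) := by
  obtain ⟨α, hα, hg⟩ := exists_ne_zero_forall_apply_eq_mul H c hc
  refine ⟨α, ⟨n, hn, ?_⟩, ?_⟩
  · rw [mem_fixedField_iff]
    intro g hgH
    rw [map_pow, hg g hgH, mul_pow, ← Units.val_pow_eq_pow_val, hcn g hgH, Units.val_one, one_mul]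
  · rw [← IsGalois.fixedField_fixingSubgroup (fixedField H ⊔ adjoin Q {α})]
    congr 1
    ext g
    rw [mem_fixingSubgroup_sup_adjoin, fixingSubgroup_fixedField, hK]
    refine and_congr_right fun h => ?_
    rw [hg g h, mul_eq_right₀ hα, Units.val_eq_one]

end

/-! ### From subgroup chains to radical towers -/

section

variable {Q E : Type*} [Field Q] [Field E] [Algebra Q E]

/-- First isomorphism theorem: it trades the quotient for an equivariant homomorphism on `H` with
kernel `K`. -/
theorem factorUIsoSubgroupOfUnits_iff {U K H : Subgroup (E ≃ₐ[Q] E)} :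
    FactorUIsoSubgroupOfUnits U K H ↔
      ∃ (hH : IsInvariantUnder U H) (ψ : H →* Eˣ), ψ.ker = K.subgroupOf H ∧
        ∀ (u : E ≃ₐ[Q] E) (hu : u ∈ U) (h : H),
          (ψ ⟨u * (h : E ≃ₐ[Q] E) * u⁻¹, hH u hu h h.2⟩ : E) = u (ψ h) := by
  constructor
  · rintro ⟨hH, hn, D, φ, hφ⟩
    refine ⟨hH, D.subtype.comp (φ.toMonoidHom.comp (QuotientGroup.mk' _)), ?_, hφ⟩
    ext h
    simp [MonoidHom.mem_ker]
  · rintro ⟨hH, ψ, hker, hψ⟩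
    have hn : (K.subgroupOf H).Normal := hker ▸ ψ.normal_ker
    exact ⟨hH, hn, ψ.range, (QuotientGroup.quotientMulEquivOfEq hker.symm).trans
      (QuotientGroup.quotientKerEquivRange ψ), hψ⟩

theorem IsInvariantUnder.le_normalizer {G : Type*} [Group G] {U H : Subgroup G}
    (h : IsInvariantUnder U H) : U ≤ Subgroup.normalizer (H : Set G) :=
  Subgroup.le_normalizer_iff.mpr h

theorem IsInvariantUnder.mem_sup_iff {G : Type*} [Group G] {U H : Subgroup G}
    (h : IsInvariantUnder U H) {g : G} : g ∈ U ⊔ H ↔ ∃ s ∈ H, ∃ u ∈ U, s * u = g := by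
  rw [← SetLike.mem_coe, sup_comm, Subgroup.coe_mul_of_right_le_normalizer_left _ _ h.le_normalizer]
  simp [Set.mem_mul]

variable [FiniteDimensional Q E] [IsGalois Q E]

/-- Extend `ψ` to `U ⊔ C'` by `c (s * u) = ψ s`. Equivariance under `U`, together with the
triviality of `C' ≤ N` on roots of unity, is exactly the cocycle identity, and `c = 1` cuts out `U ⊔
C`. -/
theorem isRadicalExtension_of_factorUIso {U N C C' : Subgroup (E ≃ₐ[Q] E)}
    (hroots : ∀ ζ : E, IsOfFinOrder ζ → ∀ g ∈ N, g ζ = ζ)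
    (hUN : U ⊓ N ≤ C) (hCC : C ≤ C') (hN : C' ≤ N) (hC : IsInvariantUnder U C)
    (hfac : FactorUIsoSubgroupOfUnits U C C') :
    IsRadicalExtension (fixedField (U ⊔ C')) (fixedField (U ⊔ C)) := by
  classical
  obtain ⟨hC', ψ, hker, hψ⟩ := factorUIsoSubgroupOfUnits_iff.mp hfac
  have hψone : ∀ s : C', ψ s = 1 ↔ (s : E ≃ₐ[Q] E) ∈ C := fun s => by
    rw [← MonoidHom.mem_ker, hker, Subgroup.mem_subgroupOf]
  have hfix : ∀ s t : C', (s : E ≃ₐ[Q] E) (ψ t) = ψ t := fun s t => by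
    refine hroots _ ?_ s (hN s.2)
    exact (Units.coeHom E).isOfFinOrder (ψ.isOfFinOrder (isOfFinOrder_of_finite t))
  have hwd : ∀ s t : C', ∀ u ∈ U, ∀ v ∈ U, (s : E ≃ₐ[Q] E) * u = t * v → ψ s = ψ t := by
    intro s t u hu v hv h
    have h1 : (t : E ≃ₐ[Q] E)⁻¹ * s = v * u⁻¹ := by
      rw [eq_mul_inv_iff_mul_eq, mul_assoc, h, inv_mul_cancel_left]
    have h2 : (t : E ≃ₐ[Q] E)⁻¹ * s ∈ C :=
      -- The quotient of two `C'`-parts lies in `U` and in `N`, hence in `C`, where `ψ` is trivial.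
      hUN ⟨by rw [h1]; exact U.mul_mem hv (U.inv_mem hu), hN (t⁻¹ * s).2⟩
    have h3 : ψ (t⁻¹ * s) = 1 := (hψone _).mpr h2
    rw [map_mul, map_inv, inv_mul_eq_one] at h3
    exact h3.symm
  -- Outside the products `s * u` the value is arbitrary; 1 is chosen.
  have hex : ∀ g : E ≃ₐ[Q] E, ∃ e : Eˣ, ∀ s : C', ∀ u ∈ U, (s : E ≃ₐ[Q] E) * u = g → e = ψ s := by
    intro g
    by_cases h : ∃ s : C', ∃ u ∈ U, (s : E ≃ₐ[Q] E) * u = g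
    · obtain ⟨s, u, hu, rfl⟩ := h
      exact ⟨ψ s, fun t v hv h => hwd s t u hu v hv h.symm⟩
    · exact ⟨1, fun s u hu hg => absurd ⟨s, u, hu, hg⟩ h⟩
  choose c hc using hex
  have hc' : ∀ (s : C') (u), u ∈ U → c (s * u) = ψ s := fun s u hu => hc _ s u hu rfl
  refine isRadicalExtension_fixedField_of_cocycle c ?_ (n := Nat.card C') Nat.card_pos ?_ ?_
  · intro g hg h hh
    obtain ⟨s, hs, u, hu, rfl⟩ := hC'.mem_sup_iff.mp hg
    obtain ⟨t, ht, v, hv, rfl⟩ := hC'.mem_sup_iff.mp hh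
    have hmul : s * u * (t * v) =
        ((⟨s, hs⟩ * ⟨u * t * u⁻¹, hC' u hu t ht⟩ : C') : E ≃ₐ[Q] E) * (u * v) := by
      simp [mul_assoc]
    rw [hmul, hc' _ _ (mul_mem hu hv), hc' ⟨s, hs⟩ u hu, hc' ⟨t, ht⟩ v hv, map_mul, Units.val_mul,
      AlgEquiv.mul_apply, ← hψ u hu ⟨t, ht⟩]
    exact congrArg _ (hfix ⟨s, hs⟩ _).symm
  · intro g hg
    obtain ⟨s, hs, u, hu, rfl⟩ := hC'.mem_sup_iff.mp hg
    rw [hc' ⟨s, hs⟩ u hu, ← map_pow, pow_card_eq_one', map_one]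
  · intro g
    rw [hC.mem_sup_iff]
    constructor
    · rintro ⟨s, hs, u, hu, rfl⟩
      exact ⟨hC'.mem_sup_iff.mpr ⟨s, hCC hs, u, hu, rfl⟩,
        (hc' ⟨s, hCC hs⟩ u hu).trans ((hψone _).mpr hs)⟩
    · rintro ⟨hg, h1⟩
      obtain ⟨s, hs, u, hu, rfl⟩ := hC'.mem_sup_iff.mp hg
      rw [hc' ⟨s, hs⟩ u hu, hψone] at h1
      exact ⟨s, h1, u, hu, rfl⟩

/-- The sign character of `H` with kernel `K` is a cocycle, since automorphisms fix 1 and -1. -/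
theorem isRadicalExtension_fixedField_of_relIndex_eq_two {H K : Subgroup (E ≃ₐ[Q] E)}
    (hKH : K ≤ H) (h2 : K.relIndex H = 2) (hE : (-1 : E) ≠ 1) :
    IsRadicalExtension (fixedField H) (fixedField K) := by
  classical
  have key : ∀ g ∈ H, ∀ h ∈ H, (g * h ∈ K ↔ (g ∈ K ↔ h ∈ K)) := fun g hg h hh =>
    Subgroup.mul_mem_iff_of_index_two (H := K.subgroupOf H) h2 (a := ⟨g, hg⟩) (b := ⟨h, hh⟩)
  refine isRadicalExtension_fixedField_of_cocycle (fun g => if g ∈ K then 1 else -1) ?_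
    two_pos ?_ ?_
  · intro g hg h hh
    by_cases h1 : g ∈ K <;> by_cases h2 : h ∈ K <;> simp [key g hg h hh, h1, h2]
  · intro g _
    by_cases h1 : g ∈ K <;> simp [h1]
  · intro g
    by_cases h1 : g ∈ K
    · simp [h1, hKH h1]
    · simp [h1, Units.ext_iff, hE]

theorem Subgroup.normal_of_commutator_mem {G : Type*} [Group G] {H : Subgroup G}
    (h : ∀ a b : G, a * b * a⁻¹ * b⁻¹ ∈ H) : H.Normal where
  conj_mem n hn g := by
    simpa using mul_mem (h g n) hn

theorem Subgroup.exists_relIndex_eq_prime {G : Type*} [Group G] [Finite G] {H : Subgroup G}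
    [H.Normal] (p : ℕ) [Fact p.Prime] (hp : p ∣ H.index) : ∃ K, H ≤ K ∧ H.relIndex K = p := by
  obtain ⟨x, hx⟩ := exists_prime_orderOf_dvd_card' (G := G ⧸ H) p hp
  refine ⟨(Subgroup.zpowers x).comap (QuotientGroup.mk' H), ?_, ?_⟩
  · exact fun g hg => by simp [(QuotientGroup.eq_one_iff g).mpr hg, one_mem]
  · have h := Subgroup.relIndex_comap (QuotientGroup.mk' H) (H := ⊥)
      ((Subgroup.zpowers x).comap (QuotientGroup.mk' H))
    rwa [MonoidHom.comap_bot, QuotientGroup.ker_mk', Subgroup.map_comap_eq_self_of_surjective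
      (QuotientGroup.mk'_surjective H), Subgroup.relIndex_bot_left, Nat.card_zpowers, hx] at h

/-- Cauchy's theorem in the abelian quotient by `H` gives a group containing `H` with index 2; it
again contains all commutators, so induction applies. -/
theorem reflTransGen_isRadicalExtension_of_index_eq_two_pow (hE : (-1 : E) ≠ 1) (k : ℕ)
    {H : Subgroup (E ≃ₐ[Q] E)} (hH : ∀ a b, a * b * a⁻¹ * b⁻¹ ∈ H) (hk : H.index = 2 ^ k) :
    Relation.ReflTransGen IsRadicalExtension ⊥ (fixedField H) := by
  induction k generalizing H with
  | zero =>
    rw [pow_zero, Subgroup.index_eq_one] at hk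
    rw [hk, IsGalois.fixedField_top]
  | succ k ih =>
    have := Subgroup.normal_of_commutator_mem hH
    obtain ⟨K, hHK, hK⟩ := Subgroup.exists_relIndex_eq_prime (H := H) 2
      (by rw [hk]; exact dvd_pow_self 2 k.succ_ne_zero)
    have hKi : K.index = 2 ^ k := by
      have := Subgroup.relIndex_mul_index hHK
      rw [hK, hk, pow_succ'] at this
      exact Nat.eq_of_mul_eq_mul_left two_pos this
    exact (ih (fun a b => hHK (hH a b)) hKi).tail
      (isRadicalExtension_fixedField_of_relIndex_eq_two hHK hK hE)

end

/-! ### From prime radical steps to subgroups -/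

section

variable {Q E : Type*} [Field Q] [Field E] [Algebra Q E]

/-- `B` is obtained from `A` by adjoining a `p`-th root of an element of `A`, with `p` prime. -/
def IsPrimeRadicalExtension (A B : IntermediateField Q E) : Prop :=
  ∃ (p : ℕ) (α : E), p.Prime ∧ α ^ p ∈ A ∧ B = A ⊔ adjoin Q {α}

theorem IsPrimeRadicalExtension.le {A B : IntermediateField Q E}
    (h : IsPrimeRadicalExtension A B) : A ≤ B := by
  obtain ⟨p, α, -, -, rfl⟩ := h
  exact le_sup_left

/-- For exponent `p * a`, adjoin `α ^ a` first, a `p`-th root over `A`; then `α` has exponent `a`.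
-/
theorem IsRadicalExtension.reflTransGen_isPrimeRadicalExtension {A B : IntermediateField Q E}
    (h : IsRadicalExtension A B) : Relation.ReflTransGen IsPrimeRadicalExtension A B := by
  obtain ⟨α, ⟨n, hn, hα⟩, rfl⟩ := h
  induction n using induction_on_primes generalizing A with
  | zero => exact absurd hn (lt_irrefl 0)
  | one =>
    rw [pow_one] at hα
    rw [sup_eq_left.mpr (adjoin_simple_le_iff.mpr hα)]
  | prime_mul p a hp ih =>
    have h1 : IsPrimeRadicalExtension A (A ⊔ adjoin Q {α ^ a}) :=
      ⟨p, α ^ a, hp, by rwa [← pow_mul, mul_comm], rfl⟩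
    have h2 : A ⊔ adjoin Q {α ^ a} ⊔ adjoin Q {α} = A ⊔ adjoin Q {α} := by
      rw [sup_assoc, sup_eq_right.mpr (adjoin_simple_le_iff.mpr
        (pow_mem (mem_adjoin_simple_self Q α) a))]
    have := ih (A := A ⊔ adjoin Q {α ^ a}) (Nat.pos_of_mul_pos_left hn)
      (le_sup_right (a := A) (mem_adjoin_simple_self Q _))
    rw [h2] at this
    exact this.head h1

/-- `C` is normal of prime index in `C'`, with factor group `U`-isomorphic to a group of units. -/
def IsKummerStep (U C C' : Subgroup (E ≃ₐ[Q] E)) : Prop :=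
  C ≤ C' ∧ (C.relIndex C').Prime ∧ (C.subgroupOf C').Normal ∧ FactorUIsoSubgroupOfUnits U C C'

/-- The Kummer map `g ↦ g α / α` takes values in the `p`-th roots of unity, so its kernel has index
1 or `p`. -/
theorem IsPrimeRadicalExtension.inf_eq_or_isKummerStep {A B L : IntermediateField Q E}
    (h : IsPrimeRadicalExtension A B) (hBL : B ≤ L) {N : Subgroup (E ≃ₐ[Q] E)} [N.Normal]
    (hroots : ∀ ζ : E, IsOfFinOrder ζ → ∀ g ∈ N, g ζ = ζ) :
    B.fixingSubgroup ⊓ N = A.fixingSubgroup ⊓ N ∨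
      IsKummerStep L.fixingSubgroup (B.fixingSubgroup ⊓ N) (A.fixingSubgroup ⊓ N) := by
  obtain ⟨p, α, hp, hαp, rfl⟩ := h
  have hAL : A ≤ L := le_sup_left.trans hBL
  have hαL : α ∈ L := hBL (le_sup_right (a := A) (mem_adjoin_simple_self Q α))
  have hle : (A ⊔ adjoin Q {α}).fixingSubgroup ⊓ N ≤ A.fixingSubgroup ⊓ N :=
    inf_le_inf_right N (fixingSubgroup_le le_sup_left)
  by_cases hα0 : α = 0
  · left
    simp [hα0]
  set u : Eˣ := Units.mk0 α hα0 with hu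
  have hup : ∀ g ∈ A.fixingSubgroup, (Units.map (g : E →* E) u / u) ^ p = 1 := by
    intro g hg
    have : g (α ^ p) = α ^ p := (mem_fixingSubgroup_iff A g).mp hg _ hαp
    rw [div_pow, div_eq_one, ← map_pow]
    ext
    simpa [hu] using this
  let ψ : (A.fixingSubgroup ⊓ N : Subgroup (E ≃ₐ[Q] E)) →* Eˣ :=
    { toFun g := Units.map ((g : E ≃ₐ[Q] E) : E →* E) u / u
      map_one' := by ext; simp
      map_mul' := fun g h => by
        have h1 : (g : E ≃ₐ[Q] E) ((h : E ≃ₐ[Q] E) α / α) = (h : E ≃ₐ[Q] E) α / α := by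
          refine hroots _ (isOfFinOrder_iff_pow_eq_one.mpr ⟨p, hp.pos, ?_⟩) g g.2.2
          simpa [hu] using congrArg Units.val (hup h h.2.1)
        have hg : (g : E ≃ₐ[Q] E) α ≠ 0 := by simpa using hα0
        ext
        rw [map_div₀, div_eq_div_iff hg hα0] at h1
        simp only [Units.val_div_eq_div_val, Units.coe_map, Units.val_mul, hu, Units.val_mk0]
        change (g : E ≃ₐ[Q] E) ((h : E ≃ₐ[Q] E) α) / α
          = (g : E ≃ₐ[Q] E) α / α * ((h : E ≃ₐ[Q] E) α / α)
        rw [div_mul_div_comm, div_eq_div_iff hα0 (mul_ne_zero hα0 hα0)]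
        linear_combination α * h1 }
  have hψ : ∀ g, (ψ g : E) = (g : E ≃ₐ[Q] E) α / α := fun g => by
    simp [ψ, hu]
  have hker : ψ.ker =
      ((A ⊔ adjoin Q {α}).fixingSubgroup ⊓ N).subgroupOf (A.fixingSubgroup ⊓ N) := by
    ext g
    rw [MonoidHom.mem_ker, Units.ext_iff, hψ, Units.val_one, div_eq_one_iff_eq hα0,
      Subgroup.mem_subgroupOf, Subgroup.mem_inf, mem_fixingSubgroup_sup_adjoin]
    exact ⟨fun h => ⟨⟨g.2.1, h⟩, g.2.2⟩, fun h => h.1.2⟩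
  have hinv : IsInvariantUnder L.fixingSubgroup (A.fixingSubgroup ⊓ N) := by
    intro v hv g hg
    have hvA := fixingSubgroup_le hAL hv
    exact ⟨Subgroup.mul_mem _ (Subgroup.mul_mem _ hvA hg.1) (Subgroup.inv_mem _ hvA),
      ‹N.Normal›.conj_mem g hg.2 v⟩
  have hdvd : ((A ⊔ adjoin Q {α}).fixingSubgroup ⊓ N).relIndex (A.fixingSubgroup ⊓ N) ∣ p := by
    have : ψ.range ≤ rootsOfUnity p E := by
      rintro _ ⟨g, rfl⟩
      exact hup g g.2.1
    have hcard : Nat.card (rootsOfUnity p E) ∣ p := by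
      have : NeZero p := ⟨hp.ne_zero⟩
      -- The `p`-th roots of unity in `E` form a cyclic group, so its order equals its exponent,
      -- which divides `p`.
      rw [← IsCyclic.exponent_eq_card]
      exact Monoid.exponent_dvd_of_forall_pow_eq_one fun ζ => Subtype.ext ζ.2
    rw [Subgroup.relIndex, ← hker, Subgroup.index_ker]
    exact (Subgroup.card_dvd_of_le this).trans hcard
  rcases (Nat.dvd_prime hp).mp hdvd with h1 | h1
  · exact Or.inl (le_antisymm hle (Subgroup.relIndex_eq_one.mp h1))
  · refine Or.inr ⟨hle, h1 ▸ hp, hker ▸ ψ.normal_ker,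
      factorUIsoSubgroupOfUnits_iff.mpr ⟨hinv, ψ, hker, ?_⟩⟩
    intro v hv g
    have hvα : v⁻¹ α = α := (mem_fixingSubgroup_iff L _).mp (inv_mem hv) α hαL
    have hvα' : v α = α := (mem_fixingSubgroup_iff L _).mp hv α hαL
    simp [hψ, hvα, hvα']

variable [FiniteDimensional Q E] [IsGalois Q E]

theorem exists_fixingSubgroup_apply_ne {A : IntermediateField Q E} {α : E} (hα : α ∉ A) :
    ∃ g ∈ A.fixingSubgroup, g α ≠ α := by
  simpa using mt mem_iff_forall_mem_fixingSubgroup.mpr hα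

/-- Adjoining a `p`-th root to a subfield of a quasireal field has degree `p`, unless trivial. -/
theorem relIndex_fixingSubgroup_of_pow_mem {A L : IntermediateField Q E} (hL : IsQuasireal L)
    {p : ℕ} (hp : p.Prime) {α : E} (hαp : α ^ p ∈ A) (hAL : A ≤ L) (hαL : α ∈ L) (hα : α ∉ A) :
    (A ⊔ adjoin Q {α}).fixingSubgroup.relIndex A.fixingSubgroup = p := by
  -- A `p`-th root `b ∈ A` would make `α / b` a root of unity of `L`, so `α = ± b ∈ A`. Hence `X ^ p
  -- - α ^ p` is irreducible.
  have hno : ∀ b : A, b ^ p ≠ ⟨α ^ p, hαp⟩ := by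
    intro b hb
    have hb' : (b : E) ^ p = α ^ p := congrArg Subtype.val hb
    have hb0 : (b : E) ≠ 0 := by
      rintro h0
      rw [h0, zero_pow hp.ne_zero, eq_comm, pow_eq_zero_iff hp.ne_zero] at hb'
      exact hα (hb' ▸ zero_mem A)
    have hfin : IsOfFinOrder (⟨α / b, div_mem hαL (hAL b.2)⟩ : L) := by
      rw [isOfFinOrder_iff_pow_eq_one]
      refine ⟨p, hp.pos, Subtype.ext ?_⟩
      simp [div_pow, hb', div_self (hb' ▸ pow_ne_zero p hb0 : α ^ p ≠ 0)]
    rcases hL.2 _ hfin with h | h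
    · have h' : α / b = 1 := congrArg Subtype.val h
      rw [div_eq_one_iff_eq hb0] at h'
      exact hα (h' ▸ b.2)
    · have h' : α / b = -1 := congrArg Subtype.val h
      rw [div_eq_iff hb0, neg_one_mul] at h'
      exact hα (h' ▸ neg_mem b.2)
  have hirr := X_pow_sub_C_irreducible_of_prime hp hno
  have hmin : minpoly A α = Polynomial.X ^ p - Polynomial.C ⟨α ^ p, hαp⟩ := by
    refine (minpoly.eq_of_irreducible_of_monic hirr ?_
      (Polynomial.monic_X_pow_sub_C _ hp.ne_zero)).symm
    simp [IntermediateField.algebraMap_apply]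
  have hdeg : Module.finrank A (adjoin A {α}) = p := by
    rw [adjoin.finrank (IsIntegral.of_finite A α), hmin, Polynomial.natDegree_X_pow_sub_C]
  have hB : A ⊔ adjoin Q {α} = (adjoin A {α}).restrictScalars Q := by
    rw [restrictScalars_adjoin_eq_sup]
  have hcard : Nat.card (A ⊔ adjoin Q {α}).fixingSubgroup * p = Nat.card A.fixingSubgroup := by
    rw [IsGalois.card_fixingSubgroup_eq_finrank, IsGalois.card_fixingSubgroup_eq_finrank, hB,
      mul_comm, ← Module.finrank_mul_finrank A (adjoin A {α}) E, hdeg]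
    rfl
  have hle : (A ⊔ adjoin Q {α}).fixingSubgroup ≤ A.fixingSubgroup := fixingSubgroup_le le_sup_left
  have := Subgroup.relIndex_mul_relIndex _ _ _ bot_le hle
  rw [Subgroup.relIndex_bot_left, Subgroup.relIndex_bot_left, ← hcard] at this
  exact Nat.eq_of_mul_eq_mul_left Nat.card_pos this

/-- The index grows by a factor dividing `p`. A factor `p` makes `B / A` normal, which for odd `p`
would put a nontrivial `p`-th root of unity in `L`. -/
theorem IsPrimeRadicalExtension.exists_index_sup_eq_two_pow {A B L : IntermediateField Q E}
    (h : IsPrimeRadicalExtension A B) (hL : IsQuasireal L) (hBL : B ≤ L)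
    {N : Subgroup (E ≃ₐ[Q] E)} (hN : ∀ a b, a * b * a⁻¹ * b⁻¹ ∈ N)
    (hA : ∃ k, (A.fixingSubgroup ⊔ N).index = 2 ^ k) :
    ∃ k, (B.fixingSubgroup ⊔ N).index = 2 ^ k := by
  obtain ⟨p, α, hp, hαp, rfl⟩ := h
  have hAL : A ≤ L := le_sup_left.trans hBL
  have hαB : α ∈ A ⊔ adjoin Q {α} := le_sup_right (a := A) (mem_adjoin_simple_self Q α)
  have hαL : α ∈ L := hBL hαB
  by_cases hα : α ∈ A
  · rwa [sup_eq_left.mpr (adjoin_simple_le_iff.mpr hα)]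
  have hidx := relIndex_fixingSubgroup_of_pow_mem hL hp hαp hAL hαL hα
  have hHB : (A ⊔ adjoin Q {α}).fixingSubgroup ≤ A.fixingSubgroup := fixingSubgroup_le le_sup_left
  set B := A ⊔ adjoin Q {α} with hB
  set P := B.fixingSubgroup ⊔ N with hP
  have hPn : P.Normal := Subgroup.normal_of_commutator_mem fun a b =>
    (le_sup_right : N ≤ P) (hN a b)
  have hPA : P ≤ A.fixingSubgroup ⊔ N := sup_le_sup_right hHB N
  have hsup : A.fixingSubgroup ⊔ P = A.fixingSubgroup ⊔ N := by
    rw [hP, ← sup_assoc, sup_eq_left.mpr hHB]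
  have hrel : P.relIndex (A.fixingSubgroup ⊔ N) = P.relIndex A.fixingSubgroup := by
    rw [← hsup, Subgroup.relIndex_sup_right]
  have hdvd : P.relIndex A.fixingSubgroup ∣ p :=
    hidx ▸ Subgroup.relIndex_dvd_of_le_left _ le_sup_left
  obtain ⟨k, hk⟩ := hA
  have hmul := Subgroup.relIndex_mul_index hPA
  rw [hrel, hk] at hmul
  rcases (Nat.dvd_prime hp).mp hdvd with h1 | h1
  · exact ⟨k, by rw [← hmul, h1, one_mul]⟩
  suffices p = 2 from ⟨k + 1, by rw [← hmul, h1, this, pow_succ']⟩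
  by_contra hp2
  -- Both groups now have index `p` in `Gal(E/A)`, so they coincide; as `P` is normal, so is
  -- `Gal(E/B)` in `Gal(E/A)`.
  have hPB : P ⊓ A.fixingSubgroup ≤ B.fixingSubgroup := by
    rw [← Subgroup.relIndex_eq_one]
    have := Subgroup.relIndex_mul_relIndex B.fixingSubgroup (P ⊓ A.fixingSubgroup)
      A.fixingSubgroup (le_inf le_sup_left hHB) inf_le_right
    rw [Subgroup.inf_relIndex_right, h1, hidx] at this
    exact Nat.eq_of_mul_eq_mul_right hp.pos (this.trans (one_mul p).symm)
  obtain ⟨g, hgA, hg⟩ := exists_fixingSubgroup_apply_ne hα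
  have hα0 : α ≠ 0 := fun h => hα (h ▸ zero_mem A)
  -- By that normality the conjugate `g α` stays in `B`, so `g α / α` lies in `L`.
  have hgB : g α ∈ B := by
    refine mem_iff_forall_mem_fixingSubgroup.mpr fun h hh => ?_
    have h2 : g⁻¹ * h * g ∈ B.fixingSubgroup := by
      refine hPB ⟨?_, Subgroup.mul_mem _
        (Subgroup.mul_mem _ (Subgroup.inv_mem _ hgA) (hHB hh)) hgA⟩
      simpa using hPn.conj_mem h ((le_sup_left : B.fixingSubgroup ≤ P) hh) g⁻¹
    have h3 : (g⁻¹ * h * g) α = α := (mem_fixingSubgroup_iff B _).mp h2 α hαB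
    have h4 : g ((g⁻¹ * h * g) α) = h (g α) := by
      simp [← AlgEquiv.mul_apply, ← mul_assoc]
    rw [← h4, h3]
  have hpow : (g α / α) ^ p = 1 := by
    rw [div_pow, ← map_pow, (mem_fixingSubgroup_iff A g).mp hgA _ hαp,
      div_self (pow_ne_zero p hα0)]
  have hfin : IsOfFinOrder (⟨g α / α, div_mem (hBL hgB) hαL⟩ : L) :=
    isOfFinOrder_iff_pow_eq_one.mpr ⟨p, hp.pos, Subtype.ext hpow⟩
  have := hL.1
  rcases hL.2 _ hfin with h | h
  · have h' : g α / α = 1 := congrArg Subtype.val h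
    exact hg ((div_eq_one_iff_eq hα0).mp h')
  · have h' : (⟨g α / α, div_mem (hBL hgB) hαL⟩ : L) ^ p = 1 := Subtype.ext hpow
    rw [h, (hp.odd_of_ne_two hp2).neg_one_pow] at h'
    norm_num at h'

end

/-! ### Assembling the chains and the main theorem -/

section

variable {Q E : Type*} [Field Q] [Field E] [Algebra Q E]

theorem isRepeatedRadicalExtension_iff_reflTransGen {A B : IntermediateField Q E} :
    IsRepeatedRadicalExtension A B ↔ Relation.ReflTransGen IsRadicalExtension A B :=
  Relation.reflTransGen_iff_exists_nat_seq.symm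

theorem Relation.ReflTransGen.isPrimeRadicalExtension {A B : IntermediateField Q E}
    (h : Relation.ReflTransGen IsRadicalExtension A B) :
    Relation.ReflTransGen IsPrimeRadicalExtension A B := by
  induction h with
  | refl => exact .refl
  | tail _ h ih => exact ih.trans h.reflTransGen_isPrimeRadicalExtension

theorem isInvariantUnder_inf {G : Type*} [Group G] (U N : Subgroup G) [N.Normal] :
    IsInvariantUnder U (U ⊓ N) := fun u hu g hg =>
  ⟨U.mul_mem (U.mul_mem hu hg.1) (U.inv_mem hu), ‹N.Normal›.conj_mem g hg.2 u⟩

theorem IntermediateField.commutator_mem_fixingSubgroup (F : IntermediateField Q E)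
    [IsAbelianGalois Q F] [Normal Q E] (a b : E ≃ₐ[Q] E) :
    a * b * a⁻¹ * b⁻¹ ∈ F.fixingSubgroup := by
  rw [← F.restrictNormalHom_ker, MonoidHom.mem_ker]
  have := mul_comm' (AlgEquiv.restrictNormalHom F a) (AlgEquiv.restrictNormalHom F b)
  simp only [map_mul, map_inv]
  rw [this]
  group

/-- Field steps that do not shrink the intersection with `N` are dropped. -/
theorem reflTransGen_isKummerStep {L B : IntermediateField Q E}
    (h : Relation.ReflTransGen IsPrimeRadicalExtension ⊥ B) (hBL : B ≤ L)
    {N : Subgroup (E ≃ₐ[Q] E)} [N.Normal]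
    (hroots : ∀ ζ : E, IsOfFinOrder ζ → ∀ g ∈ N, g ζ = ζ) :
    Relation.ReflTransGen (IsKummerStep L.fixingSubgroup) (B.fixingSubgroup ⊓ N) N := by
  induction h with
  | refl => simpa using .refl
  | tail _ h ih =>
    have ih' := ih (h.le.trans hBL)
    rcases h.inf_eq_or_isKummerStep hBL hroots with h1 | h1
    · rwa [h1]
    · exact ih'.head h1

variable [FiniteDimensional Q E] [IsGalois Q E]

theorem IntermediateField.fixingSubgroup_inf (K L : IntermediateField Q E) :
    (K ⊓ L).fixingSubgroup = K.fixingSubgroup ⊔ L.fixingSubgroup := by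
  refine le_antisymm ?_ (sup_le (fixingSubgroup_le inf_le_left) (fixingSubgroup_le inf_le_right))
  rw [← fixingSubgroup_fixedField (K.fixingSubgroup ⊔ L.fixingSubgroup)]
  refine fixingSubgroup_le (le_inf ?_ ?_)
  · exact (fixedField_le le_sup_left).trans (IsGalois.fixedField_fixingSubgroup K).le
  · exact (fixedField_le le_sup_right).trans (IsGalois.fixedField_fixingSubgroup L).le

theorem exists_index_fixingSubgroup_sup_eq_two_pow {L B : IntermediateField Q E}
    (hL : IsQuasireal L) (h : Relation.ReflTransGen IsPrimeRadicalExtension ⊥ B) (hBL : B ≤ L)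
    {N : Subgroup (E ≃ₐ[Q] E)} (hN : ∀ a b, a * b * a⁻¹ * b⁻¹ ∈ N) :
    ∃ k, (B.fixingSubgroup ⊔ N).index = 2 ^ k := by
  induction h with
  | refl => exact ⟨0, by simp⟩
  | tail _ h ih => exact h.exists_index_sup_eq_two_pow hL hBL hN (ih (h.le.trans hBL))

/-- Climbing the group chain lowers the fixed field, so each new radical step is put at the bottom
of the tower. The first two conclusions feed the induction. -/
theorem reflTransGen_isRadicalExtension_of_isKummerStep {U N C : Subgroup (E ≃ₐ[Q] E)} [N.Normal]
    (hroots : ∀ ζ : E, IsOfFinOrder ζ → ∀ g ∈ N, g ζ = ζ)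
    (h : Relation.ReflTransGen (IsKummerStep U) (U ⊓ N) C) (hCN : C ≤ N) :
    U ⊓ N ≤ C ∧ IsInvariantUnder U C ∧
      Relation.ReflTransGen IsRadicalExtension (fixedField (U ⊔ C)) (fixedField U) := by
  induction h with
  | refl =>
    refine ⟨le_rfl, isInvariantUnder_inf U N, ?_⟩
    rw [sup_eq_left.mpr inf_le_left]
  | tail _ h ih =>
    obtain ⟨h1, h2, h3⟩ := ih (h.1.trans hCN)
    exact ⟨h1.trans h.1, h.2.2.2.1,
      h3.head (isRadicalExtension_of_factorUIso hroots h1 h.1 hCN h2 h.2.2.2)⟩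

end

theorem theorem3p1 {Q E : Type*} [Field Q] [Field E] [Algebra Q E]
    [FiniteDimensional Q E] [IsGalois Q E]
    (L F : IntermediateField Q E) (hL : IsQuasireal L)
    (hF : IsAbelianGalois Q F) (hroots : ∀ ζ : E, IsOfFinOrder ζ → ζ ∈ F)
    (U N M : Subgroup (E ≃ₐ[Q] E))
    (hU : U = L.fixingSubgroup) (hN : N = F.fixingSubgroup) (hM : M = U ⊓ N) :
    IsRepeatedRadicalExtension ⊥ L ↔
      (∃ k : ℕ, Module.finrank Q (F ⊓ L : IntermediateField Q E) = 2 ^ k) ∧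
      ∃ (r : ℕ) (C : ℕ → Subgroup (E ≃ₐ[Q] E)),
        C 0 = M ∧ C r = N ∧
        (∀ i ≤ r, IsInvariantUnder U (C i)) ∧
        ∀ i < r,
          C i ≤ C (i + 1) ∧
          ((C i).relIndex (C (i + 1))).Prime ∧
          ((C i).subgroupOf (C (i + 1))).Normal ∧
          FactorUIsoSubgroupOfUnits U (C i) (C (i + 1)) := by
  have hcomm : ∀ a b, a * b * a⁻¹ * b⁻¹ ∈ N := hN ▸ F.commutator_mem_fixingSubgroup
  have hNn : N.Normal := Subgroup.normal_of_commutator_mem hcomm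
  have hfix : ∀ ζ : E, IsOfFinOrder ζ → ∀ g ∈ N, g ζ = ζ := fun ζ hζ g hg =>
    (mem_fixingSubgroup_iff F g).mp (hN ▸ hg) ζ (hroots ζ hζ)
  have hfin : Module.finrank Q (F ⊓ L : IntermediateField Q E) = (U ⊔ N).index := by
    rw [finrank_eq_fixingSubgroup_index, fixingSubgroup_inf, hU, hN, sup_comm]
  have hLU : fixedField U = L := hU ▸ IsGalois.fixedField_fixingSubgroup L
  rw [isRepeatedRadicalExtension_iff_reflTransGen, hfin]
  constructor
  · intro h
    have hp := h.isPrimeRadicalExtension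
    refine ⟨hU ▸ exists_index_fixingSubgroup_sup_eq_two_pow hL hp le_rfl hcomm, ?_⟩
    have hk := reflTransGen_isKummerStep hp le_rfl hfix
    rw [← hU, ← hM, Relation.reflTransGen_iff_exists_nat_seq] at hk
    obtain ⟨r, C, h0, hr, hC⟩ := hk
    refine ⟨r, C, h0, hr, fun i hi => ?_, hC⟩
    rcases i with _ | i
    · rw [h0, hM]
      exact isInvariantUnder_inf U N
    · exact (hC i hi).2.2.2.1
  · rintro ⟨⟨k, hk⟩, r, C, h0, hr, -, hC⟩
    have hchain : Relation.ReflTransGen (IsKummerStep U) (U ⊓ N) N :=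
      Relation.reflTransGen_iff_exists_nat_seq.mpr ⟨r, C, h0.trans hM, hr, hC⟩
    have h1 := (reflTransGen_isRadicalExtension_of_isKummerStep hfix hchain le_rfl).2.2
    rw [hLU] at h1
    refine (reflTransGen_isRadicalExtension_of_index_eq_two_pow ?_ k
      (fun a b => (le_sup_right : N ≤ U ⊔ N) (hcomm a b)) hk).trans h1
    have := hL.1
    have hL2 : (-1 : L) ≠ 1 := by norm_num
    exact fun h => hL2 (Subtype.ext h)
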